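/- Let $H$ be a complex separable infinite-dimensional Hilbert space; "ideal" means two-sided ideal of $B(H)$. Let $c_0^*$ be the set of real sequences decreasing (not necessarily strictly) to $0$, and $\ell_1^*$ the set of nonincreasing nonnegative summable sequences. For an ideal $I$ let $\Sigma(I)\subset c_0^*$ be its characteristic set, i.e. the set of the $s$-number sequences $s(X)=\langle s_1(X),s_2(X),\dots\rangle$ of the compact operators $X\in I$, where $s_n(X)$ is the distance from $X$ to the operators of rank less than $n$. Let $\mathcal L_1$ be the trace class, so $\Sigma(\mathcal L_1)=\ell_1^*$. For a summable sequence $\eta$ put $\eta_{a_\infty}:=\big\langle \frac1n\sum_{j=n+1}^\infty \eta_j\big\rangle_{n\ge1}$. For an ideal $I\neq\{0\}$ let ${}_{a_\infty}I$ and $I_{a_\infty}$ be the ideals with characteristic sets $$\Sigma({}_{a_\infty}I)=\{\xi\in\ell_1^* : \xi_{a_\infty}\in\Sigma(I)\},\qquad \Sigma(I_{a_\infty})=\{\xi\in c_0^* : \xi=O(\eta_{a_\infty})\text{ for some }\eta\in\Sigma(I\cap\mathcal L_1)\},$$ and let $I^{o\infty}:=({}_{a_\infty}I)_{a_\infty}$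 be the am-$\infty$ interior of $I$. A nonzero ideal $I$ is called am-$\infty$ open if $I=I^{o\infty}$. **Theorem.** The intersection of any nonempty family of am-$\infty$ open ideals is am-$\infty$ open. -/

import Mathlib

open Filter Topology Asymptotics

namespace OperatorIdeal

/-! Sequences `⟨ξ₁, ξ₂, ξ₃, …⟩` of real numbers are functions `ξ : ℕ → ℝ`, where `ξ n` is the
entry with (one-based) index `n + 1`. -/

/-- `c₀*`: the real sequences that decrease (not necessarily strictly) to `0`.
Such sequences are automatically nonnegative. -/
def cZeroStar : Set (ℕ → ℝ) :=
  {ξ | Antitone ξ ∧ Tendsto ξ atTop (𝓝 0)}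

/-- `ℓ₁*`: the nonincreasing, nonnegative, summable sequences. -/
def ellOneStar : Set (ℕ → ℝ) :=
  {ξ | Antitone ξ ∧ (∀ n, 0 ≤ ξ n) ∧ Summable ξ}

/-- The arithmetic mean at infinity of a summable sequence: in one-based indexing, its `N`-th
entry is `(1 / N) * ∑_{j > N} η_j`. -/
noncomputable def amInfty (η : ℕ → ℝ) : ℕ → ℝ :=
  fun n => (1 / ((n : ℝ) + 1)) * ∑' j : ℕ, η (n + 1 + j)

section Operators

variable {H : Type*} [NormedAddCommGroup H] [InnerProductSpace ℂ H]

/-- The sequence `s(X)` of the `s`-numbers of a bounded operator `X`: its entry with one-based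
index `n + 1` is the distance from `X` to the bounded operators of rank at most `n`. For a compact
operator on a Hilbert space these are the eigenvalues of `|X|` in decreasing order, repeated
according to multiplicity (and followed by zeros if `X` has finite rank). -/
noncomputable def sNumbers (X : H →L[ℂ] H) : ℕ → ℝ :=
  fun n => ⨅ A : {A : H →L[ℂ] H // LinearMap.rank (A : H →ₗ[ℂ] H) ≤ (n : Cardinal)}, ‖X - A.1‖

/-- The characteristic set `Σ(I) ⊆ c₀*` of a two-sided ideal `I` of `B(H)`: the `s`-number
sequences of the elements of `I`. (The sequence `s(X)` tends to `0` exactly if `X` is compact, so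
the condition `ξ ∈ c₀*` is automatic if `I` is a proper ideal.) -/
def charSet (I : TwoSidedIdeal (H →L[ℂ] H)) : Set (ℕ → ℝ) :=
  {ξ | ξ ∈ cZeroStar ∧ ∃ X ∈ I, sNumbers X = ξ}

/-- The two-sided ideal determined by a set `S` of sequences: the ideal generated by the operators
whose `s`-number sequence lies in `S`. If `S` is a characteristic set, this is the ideal
corresponding to `S` under the Calkin correspondence. -/
def idealOf (S : Set (ℕ → ℝ)) : TwoSidedIdeal (H →L[ℂ] H) :=
  TwoSidedIdeal.span {X | sNumbers X ∈ S}

variable (H) in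
/-- The trace class `𝓛₁`, whose characteristic set is `ℓ₁*`. -/
def traceClass : TwoSidedIdeal (H →L[ℂ] H) :=
  idealOf ellOneStar

/-- The pre-arithmetic mean at infinity of `I`: the ideal with characteristic set
`{ξ ∈ ℓ₁* | ξ_{a_∞} ∈ Σ(I)}`. -/
def preAmInfty (I : TwoSidedIdeal (H →L[ℂ] H)) : TwoSidedIdeal (H →L[ℂ] H) :=
  idealOf {ξ | ξ ∈ ellOneStar ∧ amInfty ξ ∈ charSet I}

/-- The arithmetic mean at infinity of `I`: the ideal with characteristic set
`{ξ ∈ c₀* | ξ = O(η_{a_∞}) for some η ∈ Σ(I ∩ 𝓛₁)}`. -/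
def amInftyIdeal (I : TwoSidedIdeal (H →L[ℂ] H)) : TwoSidedIdeal (H →L[ℂ] H) :=
  idealOf {ξ | ξ ∈ cZeroStar ∧ ∃ η ∈ charSet (I ⊓ traceClass H), ξ =O[atTop] amInfty η}

/-- The am-`∞` interior of `I`. -/
def amInftyInterior (I : TwoSidedIdeal (H →L[ℂ] H)) : TwoSidedIdeal (H →L[ℂ] H) :=
  amInftyIdeal (preAmInfty I)

/-- A nonzero ideal is am-`∞` open if it coincides with its am-`∞` interior. (The am-`∞`
operations are defined for nonzero ideals only.) -/
def IsAmInftyOpen (I : TwoSidedIdeal (H →L[ℂ] H)) : Prop :=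
  I ≠ ⊥ ∧ I = amInftyInterior I

end Operators

end OperatorIdeal

/-! The interior operation is monotone, so the interior of an intersection lies in each `I i`; the
work is in the other inclusion. If `X` lies in every `I i`, then `ξ = s(X)` is eventually bounded,
for each `i`, by a multiple of some `ζ_{a_∞}` lying in `I i`, but `ζ` depends on `i`. A single `η`
serving all `i` is needed.

Up to an index shift, `n · η_{a_∞}(n)` is a tail sum of a nonincreasing summable sequence, that is,
a convex sequence decreasing to `0`. So `η` comes from a nearly smallest such sequence above `n ·
ξ(n)`: a supremum of tent functions, in `exists_minimal_amInfty`. Any competitor `ζ` then satisfies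
`η_{a_∞} ≤ 2C ζ_{a_∞}(n/2)` eventually, which puts `η_{a_∞}` in every `I i`, hence in the
intersection.

The ideals are given by generators, so membership is controlled in two ways. A set of sequences
stable under the `s`-number inequalities (`IsSolid`) bounds the `s`-numbers of everything generated.
Conversely, diagonal operators in a fixed orthonormal basis realize sequences inside an ideal
(`diagSet`); a diagonal determines its operator, so `diagSet` commutes with intersections. -/

namespace OperatorIdeal

/-! ### Inequalities for `s`-numbers, and solid sets of sequences. -/

section SNumbers

variable {H : Type*} [NormedAddCommGroup H] [InnerProductSpace ℂ H]

lemma bddBelow_range_norm_sub (X : H →L[ℂ] H) (n : ℕ) :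
    BddBelow (Set.range fun A : {A : H →L[ℂ] H //
      LinearMap.rank (A : H →ₗ[ℂ] H) ≤ (n : Cardinal)} => ‖X - A.1‖) :=
  ⟨0, by rintro _ ⟨A, rfl⟩; exact norm_nonneg _⟩

instance nonempty_rank_le (n : ℕ) : Nonempty {A : H →L[ℂ] H //
    LinearMap.rank (A : H →ₗ[ℂ] H) ≤ (n : Cardinal)} :=
  ⟨⟨0, by simp [LinearMap.rank]⟩⟩

lemma sNumbers_le (X A : H →L[ℂ] H) {n : ℕ}
    (hA : LinearMap.rank (A : H →ₗ[ℂ] H) ≤ (n : Cardinal)) : sNumbers X n ≤ ‖X - A‖ :=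
  ciInf_le (bddBelow_range_norm_sub X n) ⟨A, hA⟩

lemma le_sNumbers {X : H →L[ℂ] H} {n : ℕ} {c : ℝ}
    (h : ∀ A : H →L[ℂ] H, LinearMap.rank (A : H →ₗ[ℂ] H) ≤ (n : Cardinal) → c ≤ ‖X - A‖) :
    c ≤ sNumbers X n :=
  le_ciInf fun A => h A.1 A.2

lemma sNumbers_nonneg (X : H →L[ℂ] H) (n : ℕ) : 0 ≤ sNumbers X n :=
  le_sNumbers fun _ _ => norm_nonneg _

lemma exists_norm_sub_lt (X : H →L[ℂ] H) (n : ℕ) {ε : ℝ} (hε : 0 < ε) :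
    ∃ A : H →L[ℂ] H, LinearMap.rank (A : H →ₗ[ℂ] H) ≤ (n : Cardinal) ∧
      ‖X - A‖ < sNumbers X n + ε := by
  obtain ⟨A, hA⟩ := exists_lt_of_ciInf_lt (lt_add_of_pos_right (sNumbers X n) hε)
  exact ⟨A.1, A.2, hA⟩

lemma antitone_sNumbers (X : H →L[ℂ] H) : Antitone (sNumbers X) := fun m n hmn =>
  le_sNumbers fun A hA => sNumbers_le X A (hA.trans (by exact_mod_cast hmn))

lemma sNumbers_zero : sNumbers (0 : H →L[ℂ] H) = fun _ => 0 := by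
  funext n
  refine le_antisymm ?_ (sNumbers_nonneg _ _)
  simpa using sNumbers_le (0 : H →L[ℂ] H) 0 (n := n) (by simp [LinearMap.rank])

/-- Ranks add, so each summand receives half of the rank allowance. This is the source of the
dilations `n / 2` throughout. -/
lemma sNumbers_add_le (X Y : H →L[ℂ] H) (n : ℕ) :
    sNumbers (X + Y) n ≤ sNumbers X (n / 2) + sNumbers Y (n / 2) := by
  refine le_of_forall_pos_le_add fun ε hε => ?_
  obtain ⟨A, hA, hXA⟩ := exists_norm_sub_lt X (n / 2) (half_pos hε)
  obtain ⟨B, hB, hYB⟩ := exists_norm_sub_lt Y (n / 2) (half_pos hε)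
  have hrank : LinearMap.rank ((A + B : H →L[ℂ] H) : H →ₗ[ℂ] H) ≤ (n : Cardinal) := by
    refine (LinearMap.rank_add_le (A : H →ₗ[ℂ] H) (B : H →ₗ[ℂ] H)).trans
      ((add_le_add hA hB).trans ?_)
    norm_cast
    omega
  calc sNumbers (X + Y) n ≤ ‖X + Y - (A + B)‖ := sNumbers_le _ _ hrank
    _ = ‖(X - A) + (Y - B)‖ := by congr 1; abel
    _ ≤ ‖X - A‖ + ‖Y - B‖ := norm_add_le _ _
    _ ≤ _ := by linarith

lemma sNumbers_mul_le_left (A X : H →L[ℂ] H) (n : ℕ) :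
    sNumbers (A * X) n ≤ ‖A‖ * sNumbers X n := by
  refine le_of_forall_pos_le_add fun ε hε => ?_
  obtain ⟨B, hB, hXB⟩ := exists_norm_sub_lt X n (ε := ε / (‖A‖ + 1)) (by positivity)
  have h1 : sNumbers (A * X) n ≤ ‖A * X - A * B‖ :=
    sNumbers_le _ _ ((LinearMap.rank_comp_le_right (B : H →ₗ[ℂ] H) (A : H →ₗ[ℂ] H)).trans hB)
  rw [← mul_sub] at h1
  have h2 : ‖A‖ * (ε / (‖A‖ + 1)) ≤ ε := by
    rw [mul_div_assoc', div_le_iff₀ (by positivity)]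
    nlinarith [norm_nonneg A]
  have h3 := mul_le_mul_of_nonneg_left hXB.le (norm_nonneg A)
  linarith [norm_mul_le A (X - B)]

lemma sNumbers_mul_le_right (X A : H →L[ℂ] H) (n : ℕ) :
    sNumbers (X * A) n ≤ ‖A‖ * sNumbers X n := by
  refine le_of_forall_pos_le_add fun ε hε => ?_
  obtain ⟨B, hB, hXB⟩ := exists_norm_sub_lt X n (ε := ε / (‖A‖ + 1)) (by positivity)
  have h1 : sNumbers (X * A) n ≤ ‖X * A - B * A‖ :=
    sNumbers_le _ _ ((LinearMap.rank_comp_le_left (A : H →ₗ[ℂ] H) (B : H →ₗ[ℂ] H)).trans hB)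
  rw [← sub_mul] at h1
  have h2 : ‖A‖ * (ε / (‖A‖ + 1)) ≤ ε := by
    rw [mul_div_assoc', div_le_iff₀ (by positivity)]
    nlinarith [norm_nonneg A]
  have h3 := mul_le_mul_of_nonneg_left hXB.le (norm_nonneg A)
  linarith [norm_mul_le (X - B) A]

/-- A set of sequences stable under the estimates that `s`-numbers of sums and products obey. -/
structure IsSolid (T : Set (ℕ → ℝ)) : Prop where
  zero_mem : (fun _ => 0) ∈ T
  mem_of_le : ∀ ξ₁ ∈ T, ∀ ξ₂ ∈ T, ∀ ζ : ℕ → ℝ, Antitone ζ → (∀ n, 0 ≤ ζ n) →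
    ∀ C : ℝ, 0 ≤ C → (∀ n, ζ n ≤ C * (ξ₁ (n / 2) + ξ₂ (n / 2))) → ζ ∈ T

/-- The operators whose `s`-numbers lie in a solid set form an ideal, so that they include the
ideal generated by any of them. -/
lemma IsSolid.sNumbers_mem {T S : Set (ℕ → ℝ)} (hT : IsSolid T) (hST : S ⊆ T) {X : H →L[ℂ] H}
    (hX : X ∈ idealOf (H := H) S) : sNumbers X ∈ T := by
  have hmul : ∀ (X Y : H →L[ℂ] H) (C : ℝ), 0 ≤ C → sNumbers X ∈ T →
      (∀ n, sNumbers Y n ≤ C * sNumbers X n) → sNumbers Y ∈ T := fun X Y C hC hX h =>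
    hT.mem_of_le _ hX _ hX _ (antitone_sNumbers Y) (sNumbers_nonneg Y) C hC fun n =>
      (h n).trans (mul_le_mul_of_nonneg_left (by
        linarith [antitone_sNumbers X (Nat.div_le_self n 2), sNumbers_nonneg X (n / 2)]) hC)
  -- The operators with `s`-numbers in `T` form an ideal containing the generators, hence the span.
  let J : TwoSidedIdeal (H →L[ℂ] H) := TwoSidedIdeal.mk' {X | sNumbers X ∈ T}
    (by simpa only [Set.mem_ofPred_eq, sNumbers_zero] using hT.zero_mem)
    (fun {X Y} hX hY => hT.mem_of_le _ hX _ hY _ (antitone_sNumbers _) (sNumbers_nonneg _) 1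
      zero_le_one fun n => by simpa using sNumbers_add_le X Y n)
    (fun {X} hX => hmul X (-X) ‖(-1 : H →L[ℂ] H)‖ (norm_nonneg _) hX fun n => by
      simpa using sNumbers_mul_le_left (-1) X n)
    (fun {A X} hX => hmul X (A * X) ‖A‖ (norm_nonneg _) hX (sNumbers_mul_le_left A X))
    (fun {X A} hX => hmul X (X * A) ‖A‖ (norm_nonneg _) hX (sNumbers_mul_le_right X A))
  have hle : idealOf (H := H) S ≤ J := TwoSidedIdeal.span_le.2 fun X hX => by
    simpa [J] using hST hX
  simpa [J] using hle hX

lemma idealOf_mono {S T : Set (ℕ → ℝ)} (h : S ⊆ T) : idealOf (H := H) S ≤ idealOf T :=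
  TwoSidedIdeal.span_mono fun _ hX => h hX

lemma charSet_mono {I J : TwoSidedIdeal (H →L[ℂ] H)} (h : I ≤ J) : charSet I ⊆ charSet J :=
  fun _ ⟨hξ, X, hX, hs⟩ => ⟨hξ, X, h hX, hs⟩

lemma amInftyInterior_mono {I J : TwoSidedIdeal (H →L[ℂ] H)} (h : I ≤ J) :
    amInftyInterior I ≤ amInftyInterior J := by
  have hpre : preAmInfty I ≤ preAmInfty J :=
    idealOf_mono fun _ hξ => ⟨hξ.1, charSet_mono h hξ.2⟩
  exact idealOf_mono fun _ ⟨hξ, η, hη, hO⟩ =>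
    ⟨hξ, η, charSet_mono (inf_le_inf_right _ hpre) hη, hO⟩

end SNumbers

end OperatorIdeal

namespace OperatorIdeal

/-! ### Tail sums, dilations and the arithmetic mean at infinity. -/

section Sequences

lemma hasSum_comp_div_two {f : ℕ → ℝ} (hf : Summable f) :
    HasSum (fun j => f (j / 2)) (2 * ∑' k, f k) := by
  have he : HasSum (fun k => f (2 * k / 2)) (∑' k, f k) := by simpa using hf.hasSum
  have ho : HasSum (fun k => f ((2 * k + 1) / 2)) (∑' k, f k) := by
    simpa [Nat.mul_add_div] using hf.hasSum
  simpa only [two_mul] using HasSum.even_add_odd (f := fun j => f (j / 2)) he ho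

lemma tail_nonneg {η : ℕ → ℝ} (hη : η ∈ ellOneStar) (n : ℕ) : 0 ≤ ∑' j, η (n + j) :=
  tsum_nonneg fun _ => hη.2.1 _

lemma summable_tail {η : ℕ → ℝ} (hη : η ∈ ellOneStar) (n : ℕ) : Summable fun j => η (n + j) := by
  simpa only [add_comm] using (summable_nat_add_iff n).2 hη.2.2

lemma tail_antitone {η : ℕ → ℝ} (hη : η ∈ ellOneStar) : Antitone fun n => ∑' j, η (n + j) :=
  fun _ _ h => (summable_tail hη _).tsum_le_tsum (fun j => hη.1 (by omega)) (summable_tail hη _)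

lemma tendsto_tail {η : ℕ → ℝ} : Tendsto (fun n => ∑' j, η (n + j)) atTop (𝓝 0) := by
  simpa only [add_comm] using tendsto_sum_nat_add η

lemma amInfty_eq (η : ℕ → ℝ) (n : ℕ) : amInfty η n = (∑' j, η (n + 1 + j)) / (n + 1) := by
  rw [amInfty]; ring

lemma amInfty_nonneg {η : ℕ → ℝ} (hη : η ∈ ellOneStar) (n : ℕ) : 0 ≤ amInfty η n := by
  rw [amInfty_eq]
  exact div_nonneg (tail_nonneg hη _) (by positivity)

lemma amInfty_mem_cZeroStar {η : ℕ → ℝ} (hη : η ∈ ellOneStar) : amInfty η ∈ cZeroStar := by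
  refine ⟨fun m n h => ?_, ?_⟩
  · rw [amInfty_eq, amInfty_eq]
    have h1 := tail_antitone hη (show m + 1 ≤ n + 1 by omega)
    have h2 := tail_nonneg hη (m + 1)
    have h3 : (m : ℝ) + 1 ≤ n + 1 := by exact_mod_cast Nat.succ_le_succ h
    dsimp only at h1
    gcongr
  · have h := (tendsto_one_div_add_atTop_nhds_zero_nat (𝕜 := ℝ)).mul
      ((tendsto_add_atTop_iff_nat 1).2 (tendsto_tail (η := η)))
    rw [mul_zero] at h
    exact h

lemma nonneg_of_mem_cZeroStar {ξ : ℕ → ℝ} (hξ : ξ ∈ cZeroStar) (n : ℕ) : 0 ≤ ξ n :=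
  hξ.1.le_of_tendsto hξ.2 n

lemma zero_mem_ellOneStar : (fun _ => 0) ∈ ellOneStar :=
  ⟨antitone_const, fun _ => le_rfl, summable_zero⟩

lemma summable_comp_div_two {η : ℕ → ℝ} (hη : Summable η) : Summable fun j => η (j / 2) :=
  (hasSum_comp_div_two hη).summable

lemma add_dilate_mem_ellOneStar {η₁ η₂ : ℕ → ℝ} (h₁ : η₁ ∈ ellOneStar) (h₂ : η₂ ∈ ellOneStar) :
    (fun n => η₁ (n / 2) + η₂ (n / 2)) ∈ ellOneStar :=
  ⟨fun _ _ h => add_le_add (h₁.1 (Nat.div_le_div_right h)) (h₂.1 (Nat.div_le_div_right h)),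
    fun _ => add_nonneg (h₁.2.1 _) (h₂.2.1 _),
    (summable_comp_div_two h₁.2.2).add (summable_comp_div_two h₂.2.2)⟩

lemma dilate_mem_ellOneStar {η : ℕ → ℝ} (h : η ∈ ellOneStar) :
    (fun n => η (n / 2)) ∈ ellOneStar := by
  simpa using add_dilate_mem_ellOneStar h zero_mem_ellOneStar

/-- The tail of a dilated sequence starting at an even index. -/
lemma tail_dilate {η : ℕ → ℝ} (h : η ∈ ellOneStar) (m : ℕ) :
    ∑' j, η ((2 * m + j) / 2) = 2 * ∑' j, η (m + j) := by
  rw [← (hasSum_comp_div_two (summable_tail h m)).tsum_eq]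
  refine tsum_congr fun j => ?_
  congr 1
  omega

/-- Dilating twice on the right leaves room for `2 * (n / 2 / 2 + 1) ≤ n + 1`, so `tail_dilate`
applies at an even index. This inequality fails at `n = 0`. -/
lemma amInfty_dilate_le {η : ℕ → ℝ} (h : η ∈ ellOneStar) {n : ℕ} (hn : 1 ≤ n) :
    amInfty (fun k => η (k / 2)) n ≤ 2 * amInfty η (n / 2 / 2) := by
  have hd := dilate_mem_ellOneStar h
  have h1 : ∑' j, η ((n + 1 + j) / 2) ≤ 2 * ∑' j, η (n / 2 / 2 + 1 + j) := by
    rw [← tail_dilate h]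
    exact tail_antitone hd (by omega)
  have h2 : ((n / 2 / 2 : ℕ) : ℝ) + 1 ≤ n + 1 := by
    have : n / 2 / 2 ≤ n := by omega
    exact_mod_cast Nat.succ_le_succ this
  have h3 := tail_nonneg h (n / 2 / 2 + 1)
  rw [amInfty_eq, amInfty_eq, ← mul_div_assoc]
  gcongr

lemma amInfty_le_dilate {η : ℕ → ℝ} (h : η ∈ ellOneStar) (n : ℕ) :
    amInfty η (n / 2) ≤ amInfty (fun k => η (k / 2)) n := by
  have hd := dilate_mem_ellOneStar h
  have h1 : 2 * ∑' j, η (n / 2 + 1 + j) ≤ ∑' j, η ((n + 1 + j) / 2) := by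
    rw [← tail_dilate h]
    exact tail_antitone hd (by omega)
  have h2 : (n : ℝ) + 1 ≤ 2 * ((n / 2 : ℕ) + 1) := by
    have : n + 1 ≤ 2 * (n / 2 + 1) := by omega
    exact_mod_cast this
  have h3 := tail_nonneg h (n / 2 + 1)
  rw [amInfty_eq, amInfty_eq, div_le_div_iff₀ (by positivity) (by positivity)]
  nlinarith

lemma amInfty_add {η₁ η₂ : ℕ → ℝ} (h₁ : η₁ ∈ ellOneStar) (h₂ : η₂ ∈ ellOneStar) (n : ℕ) :
    amInfty (fun k => η₁ k + η₂ k) n = amInfty η₁ n + amInfty η₂ n := by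
  simp only [amInfty_eq]
  rw [(summable_tail h₁ _).tsum_add (summable_tail h₂ _), add_div]

lemma amInfty_le_mul {ζ η : ℕ → ℝ} (hζ : ζ ∈ ellOneStar) (hη : η ∈ ellOneStar) {C : ℝ}
    (h : ∀ n, ζ n ≤ C * η n) (n : ℕ) : amInfty ζ n ≤ C * amInfty η n := by
  rw [amInfty_eq, amInfty_eq, ← mul_div_assoc, ← tsum_mul_left]
  gcongr
  exacts [summable_tail hζ _, (summable_tail hη _).mul_left C, h _]

/-- Up to constants and dilations, there is a smallest convex sequence tending to zero above
a sequence tending to zero. -/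
lemma exists_minimal_amInfty {ξ : ℕ → ℝ} (hξ : ∀ n, 0 ≤ ξ n)
    (hlim : Tendsto (fun n : ℕ => ((n : ℝ) + 1) * ξ n) atTop (𝓝 0)) :
    ∃ η ∈ ellOneStar, (∀ n, ξ n ≤ amInfty η n) ∧ ∀ ζ ∈ ellOneStar, ∀ C : ℝ, 0 ≤ C →
      (∀ᶠ n in atTop, ξ n ≤ C * amInfty ζ n) →
      ∀ᶠ n in atTop, amInfty η n ≤ 2 * C * amInfty ζ (n / 2) := by
  set f : ℕ → ℝ := fun N => ((N : ℝ) + 1) * ξ N with hf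
  have hf0 : ∀ N, 0 ≤ f N := fun N => mul_nonneg (by positivity) (hξ N)
  -- Convex decreasing pieces: the `N`-th has value `f N` at `n = N + 1`, never exceeds `2 * f N`,
  -- and vanishes from `2 * (N + 1)` on. Their supremum `u` inherits convexity and monotonicity.
  set φ : ℕ → ℕ → ℝ := fun n N => f N * max 0 (2 - n / ((N : ℝ) + 1)) with hφ
  obtain ⟨M, hM⟩ := hlim.bddAbove_range
  have hfM : ∀ N, f N ≤ M := fun N => hM ⟨N, rfl⟩
  have hφf : ∀ n N, φ n N ≤ 2 * f N := fun n N => by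
    have : max 0 (2 - n / ((N : ℝ) + 1)) ≤ 2 :=
      max_le zero_le_two (sub_le_self _ (by positivity))
    simp only [hφ]
    nlinarith [hf0 N]
  have hφ0 : ∀ n N, 0 ≤ φ n N := fun n N => mul_nonneg (hf0 N) (le_max_left _ _)
  have hbdd : ∀ n, BddAbove (Set.range (φ n)) := fun n =>
    ⟨2 * M, by rintro _ ⟨N, rfl⟩; linarith [hφf n N, hfM N]⟩
  set u : ℕ → ℝ := fun n => ⨆ N, φ n N with hu
  have hle : ∀ n N, φ n N ≤ u n := fun n N => le_ciSup (hbdd n) N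
  have hu0 : ∀ n, 0 ≤ u n := fun n => (hφ0 n 0).trans (hle n 0)
  have hφz : ∀ n N, 2 * (N + 1) ≤ n → φ n N = 0 := fun n N h => by
    have h' : (2 : ℝ) * (N + 1) ≤ n := by exact_mod_cast h
    have : 2 - n / ((N : ℝ) + 1) ≤ 0 := by
      rw [sub_nonpos, le_div_iff₀ (by positivity)]; exact h'
    simp [hφ, max_eq_left this]
  -- Only pieces with `2 * (N + 1) > n` contribute at `n`. This gives both the decay of `u` and its
  -- minimality.
  have hul : ∀ n (c : ℝ), 0 ≤ c → (∀ N, n < 2 * (N + 1) → f N ≤ c) → u n ≤ 2 * c :=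
    fun n c hc h => ciSup_le fun N => by
      rcases lt_or_ge n (2 * (N + 1)) with h' | h'
      · linarith [hφf n N, h N h']
      · rw [hφz n N h']; positivity
  have huanti : Antitone u := antitone_nat_of_succ_le fun n =>
    ciSup_le fun N => le_trans (by
      simp only [hφ]
      have := hf0 N
      gcongr
      simp) (hle n N)
  have huconv : ∀ n, 2 * u (n + 1) ≤ u n + u (n + 2) := fun n => by
    suffices h : u (n + 1) ≤ (u n + u (n + 2)) / 2 by linarith
    refine ciSup_le fun N => ?_
    have h1 := hle n N
    have h2 := hle (n + 2) N
    have h3 : 2 * φ (n + 1) N ≤ φ n N + φ (n + 2) N := by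
      simp only [hφ]
      rw [← mul_add, mul_left_comm]
      refine mul_le_mul_of_nonneg_left ?_ (hf0 N)
      push_cast
      have e : (2 : ℝ) * (2 - (n + 1) / ((N : ℝ) + 1)) =
          (2 - n / ((N : ℝ) + 1)) + (2 - (n + 2) / ((N : ℝ) + 1)) := by ring
      rcases max_cases 0 ((2 : ℝ) - (n + 1) / ((N : ℝ) + 1)) with h | h <;> rw [h.1]
      · simpa using add_nonneg (le_max_left (0 : ℝ) _) (le_max_left (0 : ℝ) _)
      · rw [e]
        exact add_le_add (le_max_right _ _) (le_max_right _ _)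
    linarith
  have hulim : Tendsto u atTop (𝓝 0) := by
    rw [Metric.tendsto_atTop]
    intro ε hε
    obtain ⟨N₀, hN₀⟩ := (Metric.tendsto_atTop.1 hlim) (ε / 4) (by positivity)
    refine ⟨2 * (N₀ + 1), fun n hn => ?_⟩
    have := hul n (ε / 4) (by positivity) fun N hN => by
      have := hN₀ N (by omega)
      rw [Real.dist_eq, sub_zero] at this
      exact (le_abs_self _).trans this.le
    rw [Real.dist_eq, sub_zero, abs_of_nonneg (hu0 n)]
    linarith
  have hsum : ∀ n, HasSum (fun j => u (n + j) - u (n + j + 1)) (u n) := fun n => by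
    rw [hasSum_iff_tendsto_nat_of_nonneg
      (fun j => sub_nonneg.2 (huanti (Nat.le_succ (n + j))))]
    have h := (tendsto_const_nhds (x := u n)).sub ((tendsto_add_atTop_iff_nat n).2 hulim)
    rw [sub_zero] at h
    refine h.congr fun k => ?_
    have := Finset.sum_range_sub' (fun j => u (n + j)) k
    simp only [add_zero] at this
    rw [add_comm k n]
    exact this.symm
  have ham : ∀ n, amInfty (fun j => u j - u (j + 1)) n = u (n + 1) / (n + 1) := fun n => by
    rw [amInfty_eq, (hsum (n + 1)).tsum_eq]
  -- Taking `η` to be the decrements of `u` makes the tail sums of `η` telescope to `u`; convexity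
  -- of `u` is monotonicity of `η`.
  refine ⟨fun j => u j - u (j + 1), ⟨antitone_nat_of_succ_le fun n => ?_, fun n => ?_, ?_⟩,
    fun n => ?_, fun ζ hζ C hC h => ?_⟩
  · linarith [huconv n]
  · exact sub_nonneg.2 (huanti (Nat.le_succ n))
  · simpa using (hsum 0).summable
  · rw [ham, le_div_iff₀ (by positivity)]
    refine le_trans (le_of_eq ?_) (hle (n + 1) n)
    have : ((n + 1 : ℕ) : ℝ) / ((n : ℝ) + 1) = 1 := by push_cast; exact div_self (by positivity)
    simp only [hφ, hf, this]
    norm_num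
    ring
  · obtain ⟨N₀, hN₀⟩ := eventually_atTop.1 h
    filter_upwards [eventually_ge_atTop (2 * N₀)] with n hn
    -- The pieces alive at `n + 1` have `N ≥ n / 2`, where `f N` is at most `C` times the tail of
    -- `ζ` from `N + 1`, hence from `n / 2 + 1`.
    have h1 := hul (n + 1) (C * ∑' j, ζ (n / 2 + 1 + j))
      (mul_nonneg hC (tail_nonneg hζ _)) fun N hN => by
        have h2 := hN₀ N (by omega)
        rw [amInfty_eq, ← mul_div_assoc, le_div_iff₀ (by positivity)] at h2
        have h3 := tail_antitone hζ (show n / 2 + 1 ≤ N + 1 by omega)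
        have h4 := mul_le_mul_of_nonneg_left h3 hC
        simp only [hf]
        linarith
    rw [ham, amInfty_eq, ← mul_div_assoc, mul_assoc]
    have h2 := mul_nonneg hC (tail_nonneg hζ (n / 2 + 1))
    have h3 : ((n / 2 : ℕ) : ℝ) + 1 ≤ n + 1 := by
      exact_mod_cast Nat.succ_le_succ (Nat.div_le_self n 2)
    gcongr

end Sequences

end OperatorIdeal

namespace OperatorIdeal

/-! ### Diagonal operators in a fixed orthonormal basis. -/

section Diagonal

variable {H : Type*} [NormedAddCommGroup H] [InnerProductSpace ℂ H]

lemma exists_hilbertBasis_nat [CompleteSpace H] [TopologicalSpace.SeparableSpace H]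
    (hH : ¬ FiniteDimensional ℂ H) : Nonempty (HilbertBasis ℕ ℂ H) := by
  obtain ⟨w, b, hb⟩ := exists_hilbertBasis ℂ H
  have hinf : Infinite w := by
    by_contra h
    rw [not_infinite_iff_finite] at h
    have := Fintype.ofFinite w
    exact hH b.toOrthonormalBasis.toBasis.finiteDimensional_of_finite
  have hcount : Countable w := by
    -- Distinct basis vectors are `√2` apart, so balls of radius `1 / 2` about them are disjoint;
    -- separability allows only countably many.
    have hdist : ∀ i j : w, i ≠ j → ‖b i - b j‖ * ‖b i - b j‖ = 2 := fun i j hij => by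
      have h := norm_sub_mul_self (𝕜 := ℂ) (x := b i) (y := b j)
      rw [b.orthonormal.2 hij, b.orthonormal.1, b.orthonormal.1] at h
      norm_num at h
      exact h
    have hd : (Set.univ : Set w).PairwiseDisjoint fun i => Metric.ball (b i) (1 / 2) := by
      intro i _ j _ hij
      refine Metric.ball_disjoint_ball ?_
      rw [dist_eq_norm]
      nlinarith [hdist i j hij, norm_nonneg (b i - b j)]
    exact Set.countable_univ_iff.1 (hd.countable_of_isOpen (fun _ _ => Metric.isOpen_ball)
      fun i _ => ⟨b i, Metric.mem_ball_self (by norm_num)⟩)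
  obtain ⟨e⟩ := nonempty_denumerable_iff.2 ⟨hcount, hinf⟩
  let f : ℕ ≃ w := (Denumerable.eqv w).symm
  refine ⟨HilbertBasis.mk (b.orthonormal.comp f f.injective) ?_⟩
  rw [f.surjective.range_comp, b.dense_span]

variable (b : HilbertBasis ℕ ℂ H)

lemma norm_le_of_repr_le {x y : H} {C : ℝ} (hC : 0 ≤ C)
    (h : ∀ n, ‖b.repr y n‖ ≤ C * ‖b.repr x n‖) : ‖y‖ ≤ C * ‖x‖ := by
  have h1 : ‖b.repr y‖ ≤ ‖(C : ℂ) • b.repr x‖ := lp.norm_mono two_ne_zero fun n => by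
    rw [lp.coeFn_smul, Pi.smul_apply, norm_smul, Complex.norm_real, Real.norm_of_nonneg hC]
    exact h n
  rwa [norm_smul, Complex.norm_real, Real.norm_of_nonneg hC, b.repr.norm_map, b.repr.norm_map]
    at h1

/-- Weighted substitution operators with respect to an orthonormal basis. -/
lemma exists_weighted_substitution (a : ℕ → ℝ) (σ : ℕ → ℕ) {C : ℝ} (ha : ∀ n, |a n| ≤ C)
    (hσ : ∀ m n, a m ≠ 0 → a n ≠ 0 → σ m = σ n → m = n) :
    ∃ W : H →L[ℂ] H, ∀ x n, b.repr (W x) n = a n * b.repr x (σ n) := by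
  have hC : 0 ≤ C := (abs_nonneg _).trans (ha 0)
  have h2 : 0 < (2 : ENNReal).toReal := by norm_num
  have key : ∀ (x : lp (fun _ : ℕ => ℂ) 2) (s : Finset ℕ),
      ∑ n ∈ s, ‖(a n : ℂ) * x (σ n)‖ ^ (2 : ENNReal).toReal ≤
        (C * ‖x‖) ^ (2 : ENNReal).toReal := fun x s => by
    -- Since `σ` is injective where `a` is nonzero, each coordinate of `x` is used at most once.
    have h3 := lp.sum_rpow_le_norm_rpow h2 x ((s.filter fun n => a n ≠ 0).image σ)
    rw [Finset.sum_image fun m hm n hn h => hσ m n (Finset.mem_filter.1 hm).2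
      (Finset.mem_filter.1 hn).2 h] at h3
    rw [← Finset.sum_filter_of_ne (p := fun n => a n ≠ 0)]
    · rw [Real.mul_rpow hC (norm_nonneg _)]
      refine le_trans ?_ (mul_le_mul_of_nonneg_left h3 (by positivity))
      rw [Finset.mul_sum]
      refine Finset.sum_le_sum fun n _ => ?_
      rw [← Real.mul_rpow hC (norm_nonneg _), norm_mul]
      gcongr
      simpa using ha n
    · rintro n _ h h0
      exact h (by simp [h0])
  let L : lp (fun _ : ℕ => ℂ) 2 →ₗ[ℂ] lp (fun _ : ℕ => ℂ) 2 :=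
    { toFun := fun x => ⟨fun n => a n * x (σ n), memℓp_gen' (key x)⟩
      map_add' := fun x y => by
        ext n
        exact mul_add _ _ _
      map_smul' := fun c x => by
        ext n
        simp [mul_left_comm] }
  let M := L.mkContinuous C fun x =>
    lp.norm_le_of_forall_sum_le h2 (mul_nonneg hC (norm_nonneg x)) (key x)
  refine ⟨(b.repr.symm.toContinuousLinearEquiv : _ →L[ℂ] H) ∘L M ∘L
    (b.repr.toContinuousLinearEquiv : H →L[ℂ] _), fun x n => ?_⟩
  simp [M, L]

/-- `X` is diagonal with respect to `b`, with diagonal entries `ζ`. -/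
def IsDiag (X : H →L[ℂ] H) (ζ : ℕ → ℝ) : Prop :=
  ∀ x n, b.repr (X x) n = ζ n * b.repr x n

lemma exists_isDiag {ζ : ℕ → ℝ} {C : ℝ} (h : ∀ n, |ζ n| ≤ C) : ∃ X, IsDiag b X ζ :=
  exists_weighted_substitution b ζ id h fun _ _ _ _ h => h

lemma repr_basis (k m : ℕ) : b.repr (b k) m = if m = k then 1 else 0 := by
  rw [b.repr_apply_apply, orthonormal_iff_ite.1 b.orthonormal]

lemma rank_le_of_isDiag {A : H →L[ℂ] H} {ζ : ℕ → ℝ} (hA : IsDiag b A ζ) {n : ℕ}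
    (h : ∀ m, n ≤ m → ζ m = 0) : LinearMap.rank (A : H →ₗ[ℂ] H) ≤ (n : Cardinal) := by
  classical
  have hle : LinearMap.range (A : H →ₗ[ℂ] H) ≤
      Submodule.span ℂ (((Finset.range n).image b : Finset H) : Set H) := by
    rintro _ ⟨x, rfl⟩
    have h1 := b.hasSum_repr (A x)
    have h2 : ∀ m ∉ Finset.range n, b.repr (A x) m • b m = 0 := fun m hm => by
      rw [hA, h m (by simpa using hm)]
      simp
    have h3 := h1.unique (hasSum_sum_of_ne_finset_zero h2)
    change A x ∈ _
    rw [h3]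
    exact Submodule.sum_mem _ fun m hm => Submodule.smul_mem _ _
      (Submodule.subset_span (by exact_mod_cast Finset.mem_image_of_mem b hm))
  refine (Submodule.rank_mono hle).trans ((rank_span_finset_le _).trans ?_)
  exact_mod_cast Finset.card_image_le.trans (Finset.card_range n).le

lemma sNumbers_eq_of_isDiag {X : H →L[ℂ] H} {ζ : ℕ → ℝ} (hX : IsDiag b X ζ)
    (hanti : Antitone ζ) (hnonneg : ∀ n, 0 ≤ ζ n) : sNumbers X = ζ := by
  funext n
  refine le_antisymm ?_ (le_sNumbers fun A hA => ?_)
  -- Upper bound: truncating the diagonal after `n` entries leaves an error of norm at most `ζ n`.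
  · obtain ⟨A, hA⟩ := exists_isDiag b (ζ := fun m => if m < n then ζ m else 0) (C := ζ 0)
      fun m => by
        split_ifs
        · rw [abs_of_nonneg (hnonneg m)]; exact hanti m.zero_le
        · simpa using hnonneg 0
    refine (sNumbers_le X A (rank_le_of_isDiag b hA fun m hm => by simp [hm.not_gt])).trans ?_
    refine ContinuousLinearMap.opNorm_le_bound _ (hnonneg n) fun x =>
      norm_le_of_repr_le b (hnonneg n) fun m => ?_
    rw [sub_apply, map_sub, lp.coeFn_sub, Pi.sub_apply, hX, hA]
    beta_reduce
    split_ifs with h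
    · simpa using mul_nonneg (hnonneg n) (norm_nonneg _)
    · have : ζ m ≤ ζ n := hanti (not_lt.1 h)
      simp only [Complex.ofReal_zero, zero_mul, sub_zero, norm_mul, Complex.norm_real,
        Real.norm_of_nonneg (hnonneg m)]
      gcongr
  -- Lower bound: an `A` of rank at most `n` kills some nonzero vector in the span of the first `n +
  -- 1` basis vectors, and there `X` expands norms by at least `ζ n`.
  · let g : (Fin (n + 1) → ℂ) →ₗ[ℂ] H := Fintype.linearCombination ℂ fun k : Fin (n + 1) => b k
    have hfin : Module.Finite ℂ (LinearMap.range (A : H →ₗ[ℂ] H)) :=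
      Module.rank_lt_aleph0_iff.1 (hA.trans_lt (Cardinal.natCast_lt_aleph0))
    have hker : LinearMap.ker ((A : H →ₗ[ℂ] H).rangeRestrict ∘ₗ g) ≠ ⊥ := by
      refine LinearMap.ker_ne_bot_of_finrank_lt ?_
      rw [Module.finrank_fin_fun]
      exact Nat.lt_succ_of_le (Module.finrank_le_of_rank_le hA)
    obtain ⟨c, hc, hc0⟩ := Submodule.exists_mem_ne_zero_of_ne_bot hker
    have hAx : A (g c) = 0 := by
      have := congrArg Subtype.val (LinearMap.mem_ker.1 hc)
      simpa using this
    have hx0 : g c ≠ 0 := fun h => hc0 (by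
      have hli := b.orthonormal.linearIndependent.comp (fun k : Fin (n + 1) => (k : ℕ))
        Fin.val_injective
      have := Fintype.linearIndependent_iff.1 hli c (by
        simpa [g, Fintype.linearCombination_apply] using h)
      exact funext this)
    have hrepr : ∀ m, n < m → b.repr (g c) m = 0 := fun m hm => by
      rw [b.repr_apply_apply]
      simp only [g, Fintype.linearCombination_apply, inner_sum, inner_smul_right]
      refine Finset.sum_eq_zero fun k _ => ?_
      rw [b.orthonormal.2 (by omega : m ≠ k), mul_zero]
    have h1 : ‖((ζ n : ℝ) : ℂ) • g c‖ ≤ 1 * ‖X (g c)‖ :=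
      norm_le_of_repr_le b zero_le_one fun m => by
        rw [hX, one_mul, map_smul, lp.coeFn_smul, Pi.smul_apply, smul_eq_mul, norm_mul, norm_mul]
        rcases lt_or_ge n m with h | h
        · simp [hrepr m h]
        · simp only [Complex.norm_real, Real.norm_of_nonneg (hnonneg _)]
          gcongr
          exact hanti h
    have h2 : X (g c) = (X - A) (g c) := by simp [hAx]
    rw [norm_smul, one_mul, h2, Complex.norm_real, Real.norm_of_nonneg (hnonneg n)] at h1
    exact le_of_mul_le_mul_right (h1.trans ((X - A).le_opNorm _)) (norm_pos_iff.2 hx0)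

/-- The sequences of the diagonals of the diagonal operators in an ideal. -/
def diagSet (I : TwoSidedIdeal (H →L[ℂ] H)) : Set (ℕ → ℝ) :=
  {ζ | ∃ X ∈ I, IsDiag b X ζ}

variable {b} {I : TwoSidedIdeal (H →L[ℂ] H)}

lemma charSet_of_mem_diagSet {ζ : ℕ → ℝ} (h : ζ ∈ diagSet b I) (hζ : ζ ∈ cZeroStar) :
    ζ ∈ charSet I := by
  obtain ⟨X, hX, hXζ⟩ := h
  exact ⟨hζ, X, hX, sNumbers_eq_of_isDiag b hXζ hζ.1 (nonneg_of_mem_cZeroStar hζ)⟩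

lemma abs_le_of_mem_cZeroStar {ζ : ℕ → ℝ} (hζ : ζ ∈ cZeroStar) (n : ℕ) : |ζ n| ≤ ζ 0 := by
  rw [abs_of_nonneg (nonneg_of_mem_cZeroStar hζ n)]
  exact hζ.1 n.zero_le

/-- Membership of diagonal operators in the ideal given by a set of sequences. -/
lemma mem_diagSet_idealOf {S : Set (ℕ → ℝ)} {ζ : ℕ → ℝ} (h : ζ ∈ S) (hζ : ζ ∈ cZeroStar) :
    ζ ∈ diagSet b (idealOf S) := by
  obtain ⟨X, hX⟩ := exists_isDiag b (abs_le_of_mem_cZeroStar hζ)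
  refine ⟨X, TwoSidedIdeal.subset_span ?_, hX⟩
  have := sNumbers_eq_of_isDiag b hX hζ.1 (nonneg_of_mem_cZeroStar hζ)
  simpa [this] using h

lemma mul_mem_diagSet {ζ a : ℕ → ℝ} {C : ℝ} (h : ζ ∈ diagSet b I) (ha : ∀ n, |a n| ≤ C) :
    (fun n => a n * ζ n) ∈ diagSet b I := by
  obtain ⟨X, hX, hXζ⟩ := h
  obtain ⟨A, hA⟩ := exists_isDiag b ha
  refine ⟨A * X, I.mul_mem_left _ _ hX, fun x n => ?_⟩
  rw [mul_apply_eq_comp, hA, hXζ]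
  push_cast
  ring

lemma add_mem_diagSet {ζ₁ ζ₂ : ℕ → ℝ} (h₁ : ζ₁ ∈ diagSet b I) (h₂ : ζ₂ ∈ diagSet b I) :
    (fun n => ζ₁ n + ζ₂ n) ∈ diagSet b I := by
  obtain ⟨X, hX, hXζ⟩ := h₁
  obtain ⟨Y, hY, hYζ⟩ := h₂
  refine ⟨X + Y, I.add_mem hX hY, fun x n => ?_⟩
  rw [add_apply, map_add, lp.coeFn_add, Pi.add_apply, hXζ, hYζ]
  push_cast
  ring

/-- A nonzero `X` in the ideal, placed between two rank-one operators, becomes any prescribed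
multiple of the projection onto `b k`. -/
lemma single_mem_diagSet (hI : I ≠ ⊥) (k : ℕ) (c : ℝ) :
    (fun n => if n = k then c else 0) ∈ diagSet b I := by
  obtain ⟨X, hX, hX0⟩ : ∃ X ∈ I, X ≠ 0 := by
    by_contra! h
    refine hI (le_antisymm (fun X hX => ?_) bot_le)
    rw [h X hX]
    exact zero_mem _
  obtain ⟨x, hx⟩ : ∃ x, X x ≠ 0 := by
    by_contra! h
    exact hX0 (ContinuousLinearMap.ext h)
  let A := InnerProductSpace.rankOne ℂ (b k) (X x)
  let B := ((c : ℂ) / (inner ℂ (X x) (X x))) • InnerProductSpace.rankOne ℂ x (b k)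
  refine ⟨A * X * B, I.mul_mem_right _ _ (I.mul_mem_left _ _ hX), fun y n => ?_⟩
  have hne : inner ℂ (X x) (X x) ≠ 0 := inner_self_ne_zero.2 hx
  simp only [mul_apply_eq_comp, A, B, InnerProductSpace.rankOne_apply, map_smul, smul_apply,
    lp.coeFn_smul, Pi.smul_apply, smul_eq_mul, repr_basis]
  rw [← b.repr_apply_apply]
  split_ifs with h
  · rw [h]; field_simp
  · simp

lemma mem_diagSet_of_finite (hI : I ≠ ⊥) (N : ℕ) :
    ∀ ζ : ℕ → ℝ, (∀ n, N ≤ n → ζ n = 0) → ζ ∈ diagSet b I := by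
  induction N with
  | zero =>
    intro ζ h
    refine ⟨0, I.zero_mem, fun x n => ?_⟩
    simp [h n n.zero_le]
  | succ N ih =>
    intro ζ h
    have h1 := add_mem_diagSet (ih (fun n => if n = N then 0 else ζ n) fun n hn => by
      split_ifs with h'
      · rfl
      · exact h n (by omega)) (single_mem_diagSet hI N (ζ N))
    convert h1 using 2 with n
    split_ifs with h'
    · simp [h']
    · simp

lemma mem_diagSet_of_eventually_le (hI : I ≠ ⊥) {ζ ξ : ℕ → ℝ} (hζ : ζ ∈ diagSet b I) {C : ℝ}
    (h : ∀ᶠ n in atTop, |ξ n| ≤ C * |ζ n|) : ξ ∈ diagSet b I := by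
  obtain ⟨N, hN⟩ := eventually_atTop.1 h
  have h1 := mul_mem_diagSet (a := fun n => if n < N then 0 else ξ n / ζ n) (C := |C|) hζ
    fun n => by
      split_ifs with h'
      · simp
      · rw [abs_div]
        refine div_le_of_le_mul₀ (abs_nonneg _) (abs_nonneg _) ((hN n (not_lt.1 h')).trans ?_)
        gcongr
        exact le_abs_self C
  have h2 := mem_diagSet_of_finite (b := b) hI N (fun n => if n < N then ξ n else 0)
    fun n hn => by simp [hn.not_gt]
  convert add_mem_diagSet h1 h2 using 2 with n
  split_ifs with h'
  · simp
  -- Where `ζ n = 0` the bound forces `ξ n = 0`, so the quotient `ξ n / ζ n`, then `0` by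
  -- convention, does no harm.
  · by_cases h0 : ζ n = 0
    · have := hN n (not_lt.1 h')
      simp only [h0, abs_zero, mul_zero] at this
      simp [abs_nonpos_iff.1 this]
    · simp [h0]

lemma dilate_mem_diagSet {ζ : ℕ → ℝ} (h : ζ ∈ diagSet b I) :
    (fun n => ζ (n / 2)) ∈ diagSet b I := by
  obtain ⟨X, hX, hXζ⟩ := h
  -- `V` reads the coordinates of residue `r` modulo `2` and `W` puts them back, so `W * X * V` is a
  -- copy of `X` on that residue class.
  have key : ∀ r < 2, (fun n => if n % 2 = r then ζ (n / 2) else 0) ∈ diagSet b I := by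
    intro r hr
    obtain ⟨V, hV⟩ := exists_weighted_substitution b (fun _ => 1) (fun n => 2 * n + r) (C := 1)
      (by simp) fun m n _ _ h => by omega
    obtain ⟨W, hW⟩ := exists_weighted_substitution b (fun n => if n % 2 = r then 1 else 0)
      (fun n => n / 2) (C := 1) (fun n => by split_ifs <;> simp)
      fun m n hm hn h => by
        simp only [ne_eq, ite_eq_right_iff, one_ne_zero, imp_false, not_not] at hm hn
        omega
    refine ⟨W * X * V, I.mul_mem_right _ _ (I.mul_mem_left _ _ hX), fun x n => ?_⟩
    rw [mul_apply_eq_comp, mul_apply_eq_comp, hW, hXζ, hV]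
    beta_reduce
    split_ifs with h
    · rw [show 2 * (n / 2) + r = n by omega]
      simp
    · simp
  convert add_mem_diagSet (key 0 (by norm_num)) (key 1 (by norm_num)) using 2 with n
  rcases Nat.mod_two_eq_zero_or_one n with h | h <;> simp [h]

end Diagonal

end OperatorIdeal

namespace OperatorIdeal

/-! ### Solid sets attached to an ideal, and its am-`∞` interior. -/

section Interior

variable {H : Type*} [NormedAddCommGroup H] [InnerProductSpace ℂ H]
  {b : HilbertBasis ℕ ℂ H} {I : TwoSidedIdeal (H →L[ℂ] H)}

lemma tendsto_zero_of_le_dilate {ζ ξ₁ ξ₂ : ℕ → ℝ} {C : ℝ} (h₁ : Tendsto ξ₁ atTop (𝓝 0))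
    (h₂ : Tendsto ξ₂ atTop (𝓝 0)) (h₀ : ∀ n, 0 ≤ ζ n)
    (h : ∀ n, ζ n ≤ C * (ξ₁ (n / 2) + ξ₂ (n / 2))) : Tendsto ζ atTop (𝓝 0) := by
  have hdiv : Tendsto (fun n : ℕ => n / 2) atTop atTop :=
    tendsto_atTop_atTop.2 fun m => ⟨2 * m, fun n hn => by omega⟩
  have := ((h₁.comp hdiv).add (h₂.comp hdiv)).const_mul C
  rw [add_zero, mul_zero] at this
  exact squeeze_zero h₀ h this

lemma isSolid_cZeroStar_inter_diagSet (hI : I ≠ ⊥) : IsSolid (cZeroStar ∩ diagSet b I) where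
  zero_mem := ⟨⟨antitone_const, tendsto_const_nhds⟩, mem_diagSet_of_finite hI 0 _ fun _ _ => rfl⟩
  mem_of_le := fun ξ₁ h₁ ξ₂ h₂ ζ hζ h₀ C _ h => by
    refine ⟨⟨hζ, tendsto_zero_of_le_dilate h₁.1.2 h₂.1.2 h₀ h⟩,
      mem_diagSet_of_eventually_le hI
        (add_mem_diagSet (dilate_mem_diagSet h₁.2) (dilate_mem_diagSet h₂.2)) (C := C)
        (Eventually.of_forall fun n => ?_)⟩
    rw [abs_of_nonneg (h₀ n), abs_of_nonneg (add_nonneg (nonneg_of_mem_cZeroStar h₁.1 _)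
      (nonneg_of_mem_cZeroStar h₂.1 _))]
    exact h n

variable (b I) in
/-- The summable sequences whose arithmetic mean at infinity is the diagonal of an operator
in `I`. -/
def preAmInftySet : Set (ℕ → ℝ) :=
  {η | η ∈ ellOneStar ∧ amInfty η ∈ diagSet b I}

variable (b I) in
/-- The null sequences dominated by the arithmetic mean at infinity of a sequence in
`preAmInftySet b I`. -/
def interiorSet : Set (ℕ → ℝ) :=
  {ξ | ξ ∈ cZeroStar ∧ ∃ η ∈ preAmInftySet b I, ∃ C : ℝ, 0 ≤ C ∧
    ∀ᶠ n in atTop, ξ n ≤ C * amInfty η n}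

lemma isSolid_preAmInftySet (hI : I ≠ ⊥) : IsSolid (preAmInftySet b I) where
  zero_mem := ⟨zero_mem_ellOneStar, mem_diagSet_of_finite hI 0 _ fun n _ => by simp [amInfty]⟩
  mem_of_le := fun η₁ h₁ η₂ h₂ ζ hζ h₀ C hC h => by
    have hd := add_dilate_mem_ellOneStar h₁.1 h₂.1
    have hmem : ζ ∈ ellOneStar := ⟨hζ, h₀, (hd.2.2.mul_left C).of_nonneg_of_le h₀ h⟩
    refine ⟨hmem, mem_diagSet_of_eventually_le hI (dilate_mem_diagSet (dilate_mem_diagSet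
      (add_mem_diagSet h₁.2 h₂.2))) (C := C * 2) ?_⟩
    filter_upwards [eventually_ge_atTop 1] with n hn
    rw [abs_of_nonneg (amInfty_nonneg hmem n),
      abs_of_nonneg (add_nonneg (amInfty_nonneg h₁.1 _) (amInfty_nonneg h₂.1 _)), mul_assoc]
    refine (amInfty_le_mul hmem hd h n).trans (mul_le_mul_of_nonneg_left ?_ hC)
    rw [amInfty_add (dilate_mem_ellOneStar h₁.1) (dilate_mem_ellOneStar h₂.1), mul_add]
    exact add_le_add (amInfty_dilate_le h₁.1 hn) (amInfty_dilate_le h₂.1 hn)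

lemma isSolid_interiorSet (hI : I ≠ ⊥) : IsSolid (interiorSet b I) where
  zero_mem := ⟨⟨antitone_const, tendsto_const_nhds⟩, _, (isSolid_preAmInftySet hI).zero_mem, 0,
    le_rfl, Eventually.of_forall fun n => by simp⟩
  mem_of_le := by
    rintro ξ₁ ⟨h₁, η₁, hη₁, C₁, hC₁, hle₁⟩ ξ₂ ⟨h₂, η₂, hη₂, C₂, hC₂, hle₂⟩ ζ hζ h₀ C hC h
    have hd := add_dilate_mem_ellOneStar hη₁.1 hη₂.1
    refine ⟨⟨hζ, tendsto_zero_of_le_dilate h₁.2 h₂.2 h₀ h⟩, fun n => η₁ (n / 2) + η₂ (n / 2),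
      (isSolid_preAmInftySet hI).mem_of_le _ hη₁ _ hη₂ _ hd.1 hd.2.1 1 zero_le_one
        fun n => by rw [one_mul], C * (C₁ + C₂), by positivity, ?_⟩
    have hdiv : Tendsto (fun n : ℕ => n / 2) atTop atTop :=
      tendsto_atTop_atTop.2 fun m => ⟨2 * m, fun n hn => by omega⟩
    filter_upwards [hdiv.eventually hle₁, hdiv.eventually hle₂] with n hn₁ hn₂
    refine (h n).trans ?_
    rw [mul_assoc]
    refine mul_le_mul_of_nonneg_left ?_ hC
    rw [amInfty_add (dilate_mem_ellOneStar hη₁.1) (dilate_mem_ellOneStar hη₂.1)]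
    have e₁ := amInfty_le_dilate hη₁.1 n
    have e₂ := amInfty_le_dilate hη₂.1 n
    have p₁ := amInfty_nonneg (dilate_mem_ellOneStar hη₁.1) n
    have p₂ := amInfty_nonneg (dilate_mem_ellOneStar hη₂.1) n
    nlinarith [mul_le_mul_of_nonneg_left e₁ hC₁, mul_le_mul_of_nonneg_left e₂ hC₂,
      mul_nonneg hC₁ p₂, mul_nonneg hC₂ p₁]

/-- The diagonal operator with the same `s`-numbers as an element of an ideal generated by a set
of null sequences again lies in the ideal. -/
lemma sNumbers_mem_diagSet_idealOf {S : Set (ℕ → ℝ)} (hS : S ⊆ cZeroStar)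
    (hne : idealOf (H := H) S ≠ ⊥) {X : H →L[ℂ] H} (hX : X ∈ idealOf S) :
    sNumbers X ∈ diagSet b (idealOf S) :=
  ((isSolid_cZeroStar_inter_diagSet hne).sNumbers_mem
    (fun _ hξ => ⟨hS hξ, mem_diagSet_idealOf hξ (hS hξ)⟩) hX).2

/-- Openness presents `I` as an ideal generated through a set of null sequences; this replaces an
appeal to the Calkin correspondence. -/
lemma IsAmInftyOpen.sNumbers_mem_diagSet (hI : IsAmInftyOpen I) {X : H →L[ℂ] H} (hX : X ∈ I) :
    sNumbers X ∈ diagSet b I := by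
  obtain ⟨hne, heq⟩ := hI
  rw [heq] at hX hne ⊢
  exact sNumbers_mem_diagSet_idealOf (fun _ hξ => hξ.1) hne hX

lemma IsAmInftyOpen.sNumbers_mem_interiorSet (b : HilbertBasis ℕ ℂ H) (hI : IsAmInftyOpen I)
    {X : H →L[ℂ] H} (hX : X ∈ I) : sNumbers X ∈ interiorSet b I := by
  rw [hI.2] at hX
  refine (isSolid_interiorSet hI.1).sNumbers_mem ?_ hX
  rintro ξ ⟨hξ, _, ⟨_, Y, hY, rfl⟩, hO⟩
  have hpre : sNumbers Y ∈ preAmInftySet b I := by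
    refine (isSolid_preAmInftySet hI.1).sNumbers_mem ?_ ((TwoSidedIdeal.mem_inf _).1 hY).1
    rintro η ⟨hη, _, Z, hZ, hZη⟩
    exact ⟨hη, hZη ▸ hI.sNumbers_mem_diagSet hZ⟩
  obtain ⟨C, hC, hle⟩ := hO.exists_nonneg
  refine ⟨hξ, _, hpre, C, hC, ?_⟩
  filter_upwards [hle.bound] with n hn
  rw [Real.norm_of_nonneg (amInfty_nonneg hpre.1 n)] at hn
  exact (le_abs_self _).trans hn

/-- An operator whose `s`-numbers are dominated by the arithmetic mean at infinity of a sequence in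
`preAmInftySet b I` belongs to the am-`∞` interior of `I`. -/
lemma mem_amInftyInterior {X : H →L[ℂ] H} (hX : sNumbers X ∈ cZeroStar) {η : ℕ → ℝ}
    (hη : η ∈ preAmInftySet b I) (hle : ∀ n, sNumbers X n ≤ amInfty η n) :
    X ∈ amInftyInterior I := by
  have hη₀ : η ∈ cZeroStar := ⟨hη.1.1, hη.1.2.2.tendsto_atTop_zero⟩
  obtain ⟨Y, hY⟩ := exists_isDiag b (abs_le_of_mem_cZeroStar hη₀)
  have hs : sNumbers Y = η := sNumbers_eq_of_isDiag b hY hη₀.1 hη.1.2.1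
  have hchar := charSet_of_mem_diagSet hη.2 (amInfty_mem_cZeroStar hη.1)
  have hYmem : Y ∈ preAmInfty I ⊓ traceClass H := (TwoSidedIdeal.mem_inf _).2
    ⟨TwoSidedIdeal.subset_span (show sNumbers Y ∈ {ξ | ξ ∈ ellOneStar ∧ amInfty ξ ∈ charSet I} by
        rw [hs]; exact ⟨hη.1, hchar⟩),
      TwoSidedIdeal.subset_span (show sNumbers Y ∈ ellOneStar by rw [hs]; exact hη.1)⟩
  refine TwoSidedIdeal.subset_span ⟨hX, η, ⟨hη₀, Y, hYmem, hs⟩, IsBigO.of_bound 1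
    (Eventually.of_forall fun n => ?_)⟩
  rw [one_mul, Real.norm_of_nonneg (sNumbers_nonneg X n),
    Real.norm_of_nonneg (amInfty_nonneg hη.1 n)]
  exact hle n

/-- The witnesses from the various ideals have the same diagonal, so they are one operator. Equality
of `s`-numbers alone would not give this. -/
lemma mem_diagSet_iInf {ι : Type*} [Nonempty ι] {I : ι → TwoSidedIdeal (H →L[ℂ] H)}
    {ζ : ℕ → ℝ} (h : ∀ i, ζ ∈ diagSet b (I i)) : ζ ∈ diagSet b (⨅ i, I i) := by
  obtain ⟨X, -, hXζ⟩ := h (Classical.arbitrary ι)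
  refine ⟨X, (TwoSidedIdeal.mem_iInf _).2 fun i => ?_, hXζ⟩
  obtain ⟨Y, hY, hYζ⟩ := h i
  have : X = Y := ContinuousLinearMap.ext fun x => b.repr.injective (lp.ext (funext fun n => by
    rw [hXζ, hYζ]))
  rwa [this]

end Interior

end OperatorIdeal

open OperatorIdeal

theorem theorem3p11 {H : Type*} [NormedAddCommGroup H] [InnerProductSpace ℂ H] [CompleteSpace H]
    [TopologicalSpace.SeparableSpace H] (hH : ¬ FiniteDimensional ℂ H)
    {ι : Type*} [Nonempty ι] (I : ι → TwoSidedIdeal (H →L[ℂ] H))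
    (hI : ∀ i, OperatorIdeal.IsAmInftyOpen (I i)) :
    OperatorIdeal.IsAmInftyOpen (⨅ i, I i) := by
  obtain ⟨b⟩ := exists_hilbertBasis_nat hH
  refine ⟨fun hbot => ?_, le_antisymm (fun X hX => ?_) (le_iInf fun i => ?_)⟩
  · obtain ⟨X, hX, hXζ⟩ := mem_diagSet_iInf fun i => single_mem_diagSet (b := b) (hI i).1 0 1
    rw [hbot, TwoSidedIdeal.mem_bot] at hX
    have := hXζ (b 0) 0
    simp [hX, repr_basis] at this
  · have hmem := fun i => (hI i).sNumbers_mem_interiorSet b ((TwoSidedIdeal.mem_iInf _).1 hX i)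
    obtain ⟨i₀⟩ := ‹Nonempty ι›
    -- One member of the family suffices here: `(n + 1) * s(X)` is eventually dominated by a
    -- multiple of the tail of a summable sequence.
    have hlim : Tendsto (fun n : ℕ => ((n : ℝ) + 1) * sNumbers X n) atTop (𝓝 0) := by
      obtain ⟨_, ζ, hζ, C, hC, hle⟩ := hmem i₀
      have h0 := ((tendsto_add_atTop_iff_nat 1).2 (tendsto_tail (η := ζ))).const_mul C
      rw [mul_zero] at h0
      refine squeeze_zero' (Eventually.of_forall fun n =>
        mul_nonneg (by positivity) (sNumbers_nonneg X n)) ?_ h0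
      filter_upwards [hle] with n hn
      rw [amInfty_eq, ← mul_div_assoc, le_div_iff₀ (by positivity)] at hn
      linarith
    obtain ⟨η, hη, hle, hmin⟩ := exists_minimal_amInfty (sNumbers_nonneg X) hlim
    have : Nonempty ι := ⟨i₀⟩
    -- `η` depends on `X` alone, so its mean at infinity may be tested against each `I i`
    -- separately.
    refine mem_amInftyInterior (hmem i₀).1 ⟨hη, mem_diagSet_iInf (b := b) fun i => ?_⟩ hle
    obtain ⟨_, ζ, hζ, C, hC, hζle⟩ := hmem i
    refine mem_diagSet_of_eventually_le (hI i).1 (dilate_mem_diagSet hζ.2) (C := 2 * C) ?_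
    filter_upwards [hmin ζ hζ.1 C hC hζle] with n hn
    rwa [abs_of_nonneg (amInfty_nonneg hη n), abs_of_nonneg (amInfty_nonneg hζ.1 _)]
  · exact (amInftyInterior_mono (iInf_le I i)).trans (hI i).2.ge
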